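/- For pairwise coprime positive integers $P, Q, R > 2$ the quotient \[ Q_{\{P,Q,R\}}(x)=\frac{(x^{PQR}-1)(x^P-1)(x^Q-1)(x^R-1)}{(x^{PQ}-1)(x^{QR}-1)(x^{RP}-1)(x-1)} \] is a polynomial with integer coefficients; let $\mathcal A_{\{P,Q,R\}}$ denote the set of its coefficients (those of $x^m$ with $0\le m\le \deg Q_{\{P,Q,R\}}$). For distinct primes $p,q,r$ and exponents with $p^a,q^b,r^c>2$, the unitary cyclotomic polynomial of order three is $\Phi^*_{p^aq^br^c}=Q_{\{p^a,q^b,r^c\}}$. Theorem 2. Fix distinct primes $p$, $q$, $r$. For every $\varepsilon>0$ there is $a_\varepsilon$ (depending only on $p,q,r,\varepsilon$) such that for every integer $a\ge a_\varepsilon$ we have $p^a>2$ and each of the following three inclusions holds for suitable exponents $b$ and $c$ with $q^b>2$ and $r^c>2$, where the choice of $b$ and $c$ may depend on the inclusion as well as on $a$: \[ \mathcal A_{\{p^a,q^b,r^c\}}\supset\{\,n\in\mathbb Z: |n|\le(\tfrac14-\varepsilon)p^a\,\}, \] \[ \mathcal A_{\{p^a,q^b,r^c\}}\supset\{\,n\in\mathbb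 Z: -1\le n\le(\tfrac12-\varepsilon)p^a\,\}, \] \[ \mathcal A_{\{p^a,q^b,r^c\}}\supset\{\,-n: n\in\mathbb Z,\ -1\le n\le(\tfrac12-\varepsilon)p^a\,\}. \] -/

import Mathlib

open Polynomial

/-- The numerator of the rational function defining `inclExclPoly`. -/
noncomputable def inclExclNum (p q r : ℕ) : ℤ[X] :=
  (X ^ (p * q * r) - 1) * (X ^ p - 1) * (X ^ q - 1) * (X ^ r - 1)

/-- The denominator of the rational function defining `inclExclPoly`. -/
noncomputable def inclExclDen (p q r : ℕ) : ℤ[X] :=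
  (X ^ (p * q) - 1) * (X ^ (q * r) - 1) * (X ^ (r * p) - 1) * (X - 1)

/-- The ternary inclusion-exclusion polynomial
`(x^(pqr) - 1)(x^p - 1)(x^q - 1)(x^r - 1) / ((x^(pq) - 1)(x^(qr) - 1)(x^(rp) - 1)(x - 1))`.
The denominator is monic, and the division is exact when `p, q, r` are positive and coprime in
pairs: see `inclExclDen_mul_inclExclPoly`. -/
noncomputable def inclExclPoly (p q r : ℕ) : ℤ[X] :=
  inclExclNum p q r /ₘ inclExclDen p q r

/-- The ternary unitary cyclotomic polynomial attached to the powers `p^a, q^b, r^c` of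
three distinct primes. -/
noncomputable def unitaryCyclotomic (p a q b r c : ℕ) : ℤ[X] :=
  inclExclPoly (p ^ a) (q ^ b) (r ^ c)

/-- The set of coefficients `a_0, ..., a_d` of an integer polynomial of degree `d`
(the zeros beyond the degree are not counted). -/
def coeffSet (f : ℤ[X]) : Set ℤ :=
  {n | ∃ m ≤ f.natDegree, f.coeff m = n}

theorem inclExclDen_monic {p q r : ℕ} (hp : 0 < p) (hq : 0 < q) (hr : 0 < r) :
    (inclExclDen p q r).Monic := by
  have h : ∀ n : ℕ, 0 < n → (X ^ n - 1 : ℤ[X]).Monic := fun n hn => by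
    simpa using monic_X_pow_sub_C (1 : ℤ) hn.ne'
  have h1 : (X - 1 : ℤ[X]).Monic := by simpa using h 1 one_pos
  exact (((h _ (Nat.mul_pos hp hq)).mul (h _ (Nat.mul_pos hq hr))).mul
    (h _ (Nat.mul_pos hr hp))).mul h1

theorem X_pow_sub_one_eq_prod_ite {n N : ℕ} (hn : n ∣ N) (hN : 0 < N) :
    (X ^ n - 1 : ℤ[X]) = ∏ d ∈ N.divisors, cyclotomic d ℤ ^ (if d ∣ n then 1 else 0) := by
  have hn0 : 0 < n := Nat.pos_of_dvd_of_pos hn hN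
  rw [← prod_cyclotomic_eq_X_pow_sub_one hn0 ℤ]
  have hs : n.divisors = N.divisors.filter (fun d => d ∣ n) := by
    ext d
    simp only [Nat.mem_divisors, Finset.mem_filter]
    exact ⟨fun h => ⟨⟨h.1.trans hn, hN.ne'⟩, h.1⟩, fun h => ⟨h.2, hn0.ne'⟩⟩
  rw [hs, Finset.prod_filter]
  refine Finset.prod_congr rfl fun d _ => ?_
  split_ifs <;> simp

theorem inclExclDen_dvd_inclExclNum {p q r : ℕ} (hp : 0 < p) (hq : 0 < q) (hr : 0 < r)
    (hpq : p.Coprime q) (hqr : q.Coprime r) (hrp : r.Coprime p) :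
    inclExclDen p q r ∣ inclExclNum p q r := by
  have hN : 0 < p * q * r := by positivity
  have e1 : (X - 1 : ℤ[X]) = X ^ 1 - 1 := by simp
  unfold inclExclDen inclExclNum
  rw [e1, X_pow_sub_one_eq_prod_ite (n := p * q * r) dvd_rfl hN,
    X_pow_sub_one_eq_prod_ite (n := p) (N := p * q * r) ⟨q * r, by ring⟩ hN,
    X_pow_sub_one_eq_prod_ite (n := q) (N := p * q * r) ⟨p * r, by ring⟩ hN,
    X_pow_sub_one_eq_prod_ite (n := r) (N := p * q * r) ⟨p * q, by ring⟩ hN,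
    X_pow_sub_one_eq_prod_ite (n := p * q) (N := p * q * r) ⟨r, by ring⟩ hN,
    X_pow_sub_one_eq_prod_ite (n := q * r) (N := p * q * r) ⟨p, by ring⟩ hN,
    X_pow_sub_one_eq_prod_ite (n := r * p) (N := p * q * r) ⟨q, by ring⟩ hN,
    X_pow_sub_one_eq_prod_ite (n := 1) (N := p * q * r) (one_dvd _) hN]
  simp only [← Finset.prod_mul_distrib, ← pow_add]
  refine Finset.prod_dvd_prod_of_dvd _ _ fun d hd => pow_dvd_pow _ ?_
  have hd' : d ∣ p * q * r := Nat.dvd_of_mem_divisors hd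
  have key : ∀ {x y z : ℕ}, x.Coprime z → d ∣ x * y → d ∣ y * z → d ∣ y := by
    intro x y z hxz h1 h2
    have h := Nat.dvd_gcd h1 h2
    rwa [mul_comm x y, Nat.gcd_mul_left, hxz, mul_one] at h
  have two : ∀ {x y : ℕ}, x.Coprime y → d ∣ x → d ∣ y → d ∣ 1 := by
    intro x y hxy h1 h2
    have h := Nat.dvd_gcd h1 h2
    rwa [hxy] at h
  have k1 := key (x := p) (y := q) (z := r) hrp.symm
  have k2 := key (x := q) (y := r) (z := p) hpq.symm
  have k3 := key (x := r) (y := p) (z := q) hqr.symm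
  have t1 := two hpq
  have t2 := two hqr
  have t3 := two hrp
  have o1 : d ∣ 1 → d ∣ p := fun h => h.trans (one_dvd _)
  have o2 : d ∣ 1 → d ∣ q := fun h => h.trans (one_dvd _)
  have o3 : d ∣ 1 → d ∣ r := fun h => h.trans (one_dvd _)
  by_cases c1 : d ∣ p * q <;> by_cases c2 : d ∣ q * r <;> by_cases c3 : d ∣ r * p <;>
    by_cases c4 : d ∣ 1 <;> by_cases c5 : d ∣ p <;> by_cases c6 : d ∣ q <;>
    by_cases c7 : d ∣ r <;> simp only [hd', c1, c2, c3, c4, c5, c6, c7, if_true, if_false] <;>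
    omega

/-- The defining quotient is a polynomial. -/
theorem inclExclDen_mul_inclExclPoly {p q r : ℕ} (hp : 0 < p) (hq : 0 < q) (hr : 0 < r)
    (hpq : p.Coprime q) (hqr : q.Coprime r) (hrp : r.Coprime p) :
    inclExclDen p q r * inclExclPoly p q r = inclExclNum p q r := by
  have h := modByMonic_add_div (inclExclNum p q r) (inclExclDen p q r)
  rwa [(modByMonic_eq_zero_iff_dvd (inclExclDen_monic hp hq hr)).2
    (inclExclDen_dvd_inclExclNum hp hq hr hpq hqr hrp), zero_add] at h

/-! One choice of `b` and `c` serves all three inclusions: it yields every integer of absolute value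
up to nearly `P / 2`, where `P = p ^ a`, `Q = q ^ b`, `R = r ^ c`.

Cancelling factors gives `inclExclPoly P Q R * (1 - X ^ (P * Q)) = B(X ^ R) * (1 - X ^ Q) * (1 + X +
... + X ^ (P - 1))`, with `B` the binary polynomial of `P, Q`. Dividing by `1 - X ^ (P * Q)` sums
the coefficients of `B` along residue classes modulo `PQ`, and each class meets at most one nonzero
coefficient. So a ternary coefficient is a difference of two windows of `P` signs
(`coeff_inclExclPoly`). For `R > 5PQ` the index runs through a whole period `PQ` while the
truncation degree `K` stays fixed. There consecutive coefficients differ by at most 1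
(`abs_windowSum_sub_le`), so it suffices to reach `v - 2` and `-(v - 2)`.

Let `v` be the inverse of `Q` modulo `P`. If `Q ≡ 2 - v` and `R ≡ v` modulo `P`, and the inverse `s`
of `PR` modulo `Q` is small, one window contains `v` signs `+1`, and shifting by `Q` destroys all
but at most two of them (`le_windowSum`, `windowSum_le`). The congruences need `v * (2 - v) ≡ 1`,
that is `(v - 1) ^ 2 ≡ 0` modulo `P`. With `P = p ^ (e + m)`, `m ≤ e`, this allows `v = 1 + p ^ e *
(p ^ m / 2)`, which is close to `P / 2`. Prime powers `Q`, `R` in the required classes exist because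
those classes are 1 modulo suitable fixed prime powers (`exists_pow_modEq_modEq`). -/

/-! ### Residues of powers modulo prime powers -/

/-- Hensel-style induction on `a`: the power of `1 + p ^ k * d` with exponent `p ^ (a - k)` is `1 +
p ^ a * e` with `p ∤ e`, so a further power of it corrects the next digit. The condition `k + 2 ≤ p
* k` only excludes `k = 1` for `p = 2`, among `k ≠ 0`. -/
theorem exists_pow_modEq_of_one_add {p : ℕ} (hp : p.Prime) {k : ℕ} (hk : k ≠ 0)
    (hkp : k + 2 ≤ p * k) {d : ℤ} (hd : ¬ (p : ℤ) ∣ d) (a : ℕ) {u : ℤ}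
    (hu : u ≡ 1 [ZMOD (p : ℤ) ^ k]) :
    ∃ c : ℕ, (1 + (p : ℤ) ^ k * d) ^ c ≡ u [ZMOD (p : ℤ) ^ a] := by
  have hpZ : Prime (p : ℤ) := Nat.prime_iff_prime_int.mp hp
  have hdiv : (p : ℤ) * p ^ k * p ∣ (p ^ k : ℤ) ^ p := by
    rw [← pow_succ', ← pow_succ, ← pow_mul, mul_comm k]
    exact pow_dvd_pow _ hkp
  have low : ∀ a ≤ k, ∃ c : ℕ, (1 + (p : ℤ) ^ k * d) ^ c ≡ u [ZMOD (p : ℤ) ^ a] := fun a ha =>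
    ⟨0, by simpa using (hu.symm.of_dvd (pow_dvd_pow _ ha))⟩
  induction a with
  | zero => exact low 0 (Nat.zero_le _)
  | succ a ih =>
    rcases Nat.lt_or_ge a k with h | h
    · exact low _ h
    obtain ⟨c, hc⟩ := ih
    obtain ⟨z, hz⟩ := hc.symm.dvd
    obtain ⟨y, hy⟩ := ZMod.exists_one_add_mul_pow_prime_pow_eq (R := ℤ) hp
      (dvd_pow_self (p : ℤ) hk) hdiv d (a - k)
    set g : ℤ := 1 + (p : ℤ) ^ k * d with hg
    have hpa : (p : ℤ) ^ (a - k) * p ^ k = p ^ a := by rw [← pow_add, Nat.sub_add_cancel h]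
    rw [hpa] at hy
    set e : ℤ := d + p * y with he
    have hcop : IsCoprime (g ^ c * e) (p : ℤ) := by
      have h1 : IsCoprime g (p : ℤ) := by
        obtain ⟨j, rfl⟩ := Nat.exists_eq_succ_of_ne_zero hk
        exact ⟨1, -(p ^ j * d), by rw [hg, pow_succ]; ring⟩
      have h2 : IsCoprime d (p : ℤ) := ((Prime.coprime_iff_not_dvd hpZ).2 hd).symm
      have h3 : IsCoprime e (p : ℤ) := by rw [he]; exact IsCoprime.add_mul_left_left h2 y
      exact h1.pow_left.mul_left h3
    obtain ⟨s, t, hst⟩ := hcop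
    -- The error is `g ^ c - u = p ^ a * z`, and `s` inverts `g ^ c * e` modulo `p`; this `i`
    -- cancels `z` modulo `p`.
    obtain ⟨i, hi⟩ : ∃ i : ℕ, (i : ℤ) ≡ -z * s [ZMOD p] := by
      refine ⟨((-z * s) % p).toNat, ?_⟩
      rw [Int.toNat_of_nonneg (Int.emod_nonneg _ (by exact_mod_cast hp.ne_zero))]
      exact Int.mod_modEq _ _
    obtain ⟨v, hv⟩ := hi.symm.dvd
    have hlin : (1 + (p : ℤ) ^ a * e) ^ i ≡ 1 + i * (p ^ a * e) [ZMOD (p : ℤ) ^ (a + 1)] := by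
      have ha : a + 1 ≤ a + a := by omega
      refine Int.ModEq.of_dvd (pow_dvd_pow _ ha) ?_
      clear hi hv
      induction i with
      | zero => simp
      | succ i ih =>
        rw [pow_succ]
        refine (ih.mul_right _).trans (Int.modEq_iff_dvd.2 ⟨-(i * e ^ 2), ?_⟩)
        push_cast
        rw [pow_add]; ring
    refine ⟨c + p ^ (a - k) * i, ?_⟩
    rw [pow_add g, pow_mul g, hy]
    refine (hlin.mul_left _).trans (Int.modEq_iff_dvd.2 ⟨-(z * t + g ^ c * e * v), ?_⟩)
    have hi' : (i : ℤ) = -z * s + p * v := by linarith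
    have hz' : g ^ c = u + p ^ a * z := by linarith
    have : (p : ℤ) ^ a * (z + i * (g ^ c * e)) = p ^ (a + 1) * (z * t + g ^ c * e * v) := by
      rw [hi', pow_succ]; linear_combination (-(p : ℤ) ^ a * z) * hst
    linear_combination -hz' - this

/-- Fermat gives `k ≥ 1` for odd `p`; the factor 2 in `2 * (p - 1)` gives `k ≥ 2` when `p = 2`, odd
squares being 1 modulo 4. -/
theorem exists_pow_eq_one_add {p r : ℕ} (hp : p.Prime) (hr : 1 < r) (hpr : p.Coprime r) {M : ℕ}
    (hM : M ≠ 0) (hpM : 2 * (p - 1) ∣ M) :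
    ∃ k : ℕ, k ≠ 0 ∧ k + 2 ≤ p * k ∧ ∃ d : ℤ, ¬ (p : ℤ) ∣ d ∧
      ((r : ℤ)) ^ M = 1 + (p : ℤ) ^ k * d := by
  have h1 : 1 < r ^ M := Nat.one_lt_pow hM hr
  obtain ⟨k, d, hd, hkd⟩ := Nat.exists_eq_pow_mul_and_not_dvd (n := r ^ M - 1) (by omega) p hp.ne_one
  have key : ∀ e, p ^ e ∣ r ^ M - 1 → e ≤ k := by
    intro e he
    by_contra! hlt
    rw [hkd] at he
    have : p ^ k * p ∣ p ^ k * d := (pow_succ p k ▸ pow_dvd_pow p hlt).trans he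
    exact hd (Nat.dvd_of_mul_dvd_mul_left (pow_pos hp.pos k) this)
  have heq : (r : ℤ) ^ M = 1 + (p : ℤ) ^ k * d := by
    have : r ^ M = 1 + p ^ k * d := by omega
    exact_mod_cast this
  have hkp : k ≠ 0 ∧ k + 2 ≤ p * k := by
    rcases hp.eq_two_or_odd' with rfl | hodd
    · have : 2 ≤ k := by
        refine key 2 ?_
        obtain ⟨m, rfl⟩ := hpM
        have hr2 : r % 2 = 1 := by
          rcases Nat.mod_two_eq_zero_or_one r with h | h
          · exact absurd (Nat.dvd_gcd dvd_rfl (Nat.dvd_of_mod_eq_zero h)) (by rw [hpr]; decide)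
          · exact h
        have h4 : r ^ 2 ≡ 1 [MOD 4] := by
          have : r % 4 = 1 ∨ r % 4 = 3 := by omega
          rcases this with h | h <;> simp [Nat.ModEq, Nat.pow_mod, h]
        have := (h4.pow m).symm
        rw [one_pow, ← pow_mul] at this
        exact (Nat.modEq_iff_dvd' (by simpa using h1.le)).1 (by simpa using this)
      omega
    · have h3 : 3 ≤ p := by
        have := hp.two_le
        rcases hodd with ⟨t, ht⟩; omega
      have : 1 ≤ k := by
        refine key 1 ?_
        obtain ⟨m, rfl⟩ := (Dvd.intro_left 2 rfl : p - 1 ∣ 2 * (p - 1)).trans hpM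
        have hf := Nat.ModEq.pow_totient hpr.symm
        rw [Nat.totient_prime hp] at hf
        have := (hf.pow m).symm
        rw [one_pow, ← pow_mul] at this
        rw [pow_one]
        exact (Nat.modEq_iff_dvd' h1.le).1 this
      exact ⟨by omega, by nlinarith⟩
  exact ⟨k, hkp.1, hkp.2, d, by exact_mod_cast hd, heq⟩

theorem pow_prime_pow_modEq_one {p : ℕ} (hp : p.Prime) {k : ℕ} (hk : k ≠ 0)
    (hkp : k + 2 ≤ p * k) (d : ℤ) (a : ℕ) :
    (1 + (p : ℤ) ^ k * d) ^ p ^ a ≡ 1 [ZMOD (p : ℤ) ^ a] := by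
  have hdiv : (p : ℤ) * p ^ k * p ∣ (p ^ k : ℤ) ^ p := by
    rw [← pow_succ', ← pow_succ, ← pow_mul, mul_comm k]
    exact pow_dvd_pow _ hkp
  obtain ⟨y, hy⟩ := ZMod.exists_one_add_mul_pow_prime_pow_eq (R := ℤ) hp
      (dvd_pow_self (p : ℤ) hk) hdiv d a
  rw [hy]
  exact Int.modEq_iff_dvd.2 ⟨-(p ^ k * (d + p * y)), by ring⟩

/-- The powers of `r` attain, simultaneously modulo powers of two primes, all residues that are
`1` modulo fixed powers of these primes. -/
theorem exists_pow_modEq_modEq {p q r : ℕ} (hp : p.Prime) (hq : q.Prime) (hpq : p ≠ q)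
    (hr : 1 < r) (hpr : p.Coprime r) (hqr : q.Coprime r) :
    ∃ k l : ℕ, ∀ (a b : ℕ) (u v : ℤ), u ≡ 1 [ZMOD (p : ℤ) ^ k] → v ≡ 1 [ZMOD (q : ℤ) ^ l] →
      ∀ B : ℕ, ∃ c, B ≤ c ∧ (r : ℤ) ^ c ≡ u [ZMOD (p : ℤ) ^ a] ∧
        (r : ℤ) ^ c ≡ v [ZMOD (q : ℤ) ^ b] := by
  set M := 2 * (p - 1) * (q - 1) with hMdef
  have hp2 := hp.two_le
  have hq2 := hq.two_le
  have hM : M ≠ 0 := by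
    have : 0 < p - 1 := by omega
    have : 0 < q - 1 := by omega
    positivity
  obtain ⟨k, hk, hkp, d, hd, hrd⟩ := exists_pow_eq_one_add hp hr hpr hM ⟨q - 1, rfl⟩
  obtain ⟨l, hl, hlq, e, he, hre⟩ := exists_pow_eq_one_add hq hr hqr hM ⟨p - 1, by rw [hMdef]; ring⟩
  refine ⟨k, l, fun a b u v hu hv B => ?_⟩
  obtain ⟨c₁, hc₁⟩ := exists_pow_modEq_of_one_add hp hk hkp hd a hu
  obtain ⟨c₂, hc₂⟩ := exists_pow_modEq_of_one_add hq hl hlq he b hv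
  have hcop : (p ^ a).Coprime (q ^ b) :=
    Nat.Coprime.pow _ _ ((Nat.coprime_primes hp hq).2 hpq)
  obtain ⟨c, hca, hcb⟩ := Nat.chineseRemainder hcop c₁ c₂
  have lift : ∀ {m x y : ℕ} {g N : ℤ}, g ^ m ≡ 1 [ZMOD N] → x ≡ y [MOD m] →
      g ^ x ≡ g ^ y [ZMOD N] := by
    intro m x y g N hg hxy
    have aux : ∀ z, g ^ z ≡ g ^ (z % m) [ZMOD N] := fun z => by
      conv_lhs => rw [← Nat.mod_add_div z m, pow_add, pow_mul]
      simpa using (hg.pow (z / m)).mul_left (g ^ (z % m))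
    refine (aux x).trans ?_
    rw [show x % m = y % m from hxy]
    exact (aux y).symm
  -- The powers of `r ^ M` depend only on the exponent modulo `p ^ a`, respectively `q ^ b`, so the
  -- Chinese remainder theorem merges the two exponents and the `B` term only adds size.
  refine ⟨M * (c + B * (p ^ a * q ^ b)), ?_, ?_, ?_⟩
  · have h1 : 0 < p ^ a * q ^ b := Nat.mul_pos (pow_pos hp.pos _) (pow_pos hq.pos _)
    have h2 : 0 < M := Nat.pos_of_ne_zero hM
    calc B ≤ B * (p ^ a * q ^ b) := Nat.le_mul_of_pos_right _ h1
      _ ≤ c + B * (p ^ a * q ^ b) := Nat.le_add_left _ _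
      _ ≤ _ := Nat.le_mul_of_pos_left _ h2
  · rw [pow_mul, hrd]
    refine (lift (pow_prime_pow_modEq_one hp hk hkp d a) ?_).trans hc₁
    refine Nat.ModEq.trans ?_ hca
    exact (Nat.modEq_iff_dvd.2 ⟨-(B * q ^ b), by push_cast; ring⟩)
  · rw [pow_mul, hre]
    refine (lift (pow_prime_pow_modEq_one hq hl hlq e b) ?_).trans hc₂
    refine Nat.ModEq.trans ?_ hcb
    exact (Nat.modEq_iff_dvd.2 ⟨-(B * p ^ a), by push_cast; ring⟩)

/-! ### Truncated binary coefficients -/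

/-- The coefficient at `k ≡ xP + yQ` modulo `PQ` of the inclusion-exclusion polynomial of `P, Q`
truncated after degree `K`, where `u` and `v` are the inverses of `P` modulo `Q` and of `Q`
modulo `P`. -/
def blockSign (P Q u v K x y : ℤ) : ℤ :=
  if x < u ∧ y < v ∧ x * P + y * Q ≤ K then 1
  else if u ≤ x ∧ v ≤ y ∧ x * P + y * Q ≤ K + P * Q then -1 else 0

/-- The lines `x = u`, `y = v` cut the plane into quadrants. Corners in one quadrant give a mixed
difference of a half-plane indicator. If only one line separates them, at most two corners on a
common side count, with opposite weights. If both do, a value in `{0, 1}` meets one in `{0, -1}`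
with equal weights. -/
theorem abs_blockSign_sub_le (P Q u v K x y x' y' : ℤ) :
    |blockSign P Q u v K x y - blockSign P Q u v K x' y - blockSign P Q u v K x y' +
      blockSign P Q u v K x' y'| ≤ 1 := by
  unfold blockSign
  generalize x * P = a
  generalize x' * P = a'
  generalize y * Q = b
  generalize y' * Q = b'
  generalize P * Q = N
  rw [abs_le]
  constructor <;> split_ifs <;> omega

/-! ### From the binary to the ternary polynomial -/

/-- The polynomial `∑ aₖ X ^ (kR)`, where `aₖ` are the coefficients of the inclusion-exclusion
polynomial of `P` and `Q`. -/
noncomputable def expandedBinary (P Q R u v : ℕ) : ℤ[X] :=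
  (∑ x ∈ Finset.range u, ∑ y ∈ Finset.range v, X ^ ((x * P + y * Q) * R)) -
    ∑ x ∈ Finset.range (Q - u), ∑ y ∈ Finset.range (P - v), X ^ ((1 + x * P + y * Q) * R)

theorem expandedBinary_mul {P Q u v : ℕ} (R : ℕ) (hu : u ≤ Q) (hv : v ≤ P)
    (huv : u * P + v * Q = P * Q + 1) :
    expandedBinary P Q R u v * ((X ^ (R * P) - 1) * (X ^ (Q * R) - 1)) =
      (X ^ (P * Q * R) - 1) * (X ^ R - 1) := by
  obtain ⟨u', rfl⟩ := Nat.exists_eq_add_of_le hu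
  obtain ⟨v', rfl⟩ := Nat.exists_eq_add_of_le hv
  unfold expandedBinary
  set P := v + v' with hP
  set Q := u + u' with hQ
  have e1 : ∀ m n : ℕ, ∀ z : ℤ[X], (∑ x ∈ Finset.range m, ∑ y ∈ Finset.range n,
      z * (X ^ (R * P)) ^ x * (X ^ (Q * R)) ^ y) * ((X ^ (R * P) - 1) * (X ^ (Q * R) - 1)) =
      z * (((X ^ (R * P)) ^ m - 1) * ((X ^ (Q * R)) ^ n - 1)) := by
    intro m n z
    rw [← geom_sum_mul _ m, ← geom_sum_mul _ n]
    have : (∑ x ∈ Finset.range m, ∑ y ∈ Finset.range n,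
      z * (X ^ (R * P)) ^ x * (X ^ (Q * R)) ^ y) = z * ((∑ x ∈ Finset.range m, (X ^ (R * P)) ^ x) *
        ∑ y ∈ Finset.range n, (X ^ (Q * R)) ^ y) := by
      rw [Finset.sum_mul_sum, Finset.mul_sum]
      refine Finset.sum_congr rfl fun x _ => ?_
      rw [Finset.mul_sum]
      exact Finset.sum_congr rfl fun y _ => by ring
    rw [this]; ring
  have f1 : (∑ x ∈ Finset.range u, ∑ y ∈ Finset.range v, (X : ℤ[X]) ^ ((x * P + y * Q) * R)) =
      ∑ x ∈ Finset.range u, ∑ y ∈ Finset.range v,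
        1 * (X ^ (R * P)) ^ x * (X ^ (Q * R)) ^ y :=
    Finset.sum_congr rfl fun x _ => Finset.sum_congr rfl fun y _ => by ring
  have f2 : (∑ x ∈ Finset.range u', ∑ y ∈ Finset.range v',
      (X : ℤ[X]) ^ ((1 + x * P + y * Q) * R)) =
      ∑ x ∈ Finset.range u', ∑ y ∈ Finset.range v',
        X ^ R * (X ^ (R * P)) ^ x * (X ^ (Q * R)) ^ y :=
    Finset.sum_congr rfl fun x _ => Finset.sum_congr rfl fun y _ => by ring
  rw [show u + u' - u = u' by omega, show v + v' - v = v' by omega, f1, f2, sub_mul, e1, e1]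
  have g1 : 1 + u' * P = v * Q := by
    have : u * P + u' * P = P * Q := by rw [hQ]; ring
    omega
  have g2 : 1 + v' * Q = u * P := by
    have : v * Q + v' * Q = P * Q := by rw [hP]; ring
    omega
  have h1 : (X : ℤ[X]) ^ R * (X ^ (R * P)) ^ u' = X ^ (v * Q * R) := by rw [← g1]; ring
  have h2 : (X : ℤ[X]) ^ R * (X ^ (Q * R)) ^ v' = X ^ (u * P * R) := by rw [← g2]; ring
  have h3 : (X : ℤ[X]) ^ R * (X ^ (R * P)) ^ u' * (X ^ (Q * R)) ^ v' = X ^ (P * Q * R) := by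
    rw [h1, ← pow_mul, ← pow_add]
    congr 1
    have : v * Q + v' * Q = P * Q := by rw [hP]; ring
    rw [← this]; ring
  have h4 : ((X : ℤ[X]) ^ (R * P)) ^ u * (X ^ (Q * R)) ^ v = X ^ (P * Q * R) * X ^ R := by
    rw [← pow_mul, ← pow_mul, ← pow_add, ← pow_add]
    congr 1
    calc _ = (u * P + v * Q) * R := by ring
      _ = _ := by rw [huv]; ring
  have h5 : ((X : ℤ[X]) ^ (R * P)) ^ u = X ^ (u * P * R) := by ring
  have h6 : ((X : ℤ[X]) ^ (Q * R)) ^ v = X ^ (v * Q * R) := by ring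
  linear_combination h4 - h3 + h1 + h2 - h5 - h6

/-- The sign `blockSign` at the residue `m` modulo `PQ`. Here `s` is the inverse of `PR` modulo `Q`,
and `QR` is `1` modulo `P`. -/
def residueSign (P Q u v s K m : ℤ) : ℤ := blockSign P Q u v K (m * s % Q) (m % P)

theorem inclExclPoly_mul {P Q R u v : ℕ} (hP : 0 < P) (hQ : 0 < Q) (hR : 0 < R)
    (hPQ : P.Coprime Q) (hQR : Q.Coprime R) (hRP : R.Coprime P) (hu : u ≤ Q) (hv : v ≤ P)
    (huv : u * P + v * Q = P * Q + 1) :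
    inclExclPoly P Q R * (1 - X ^ (P * Q)) =
      expandedBinary P Q R u v * (1 - X ^ Q) * ∑ j ∈ Finset.range P, X ^ j := by
  have h := inclExclDen_mul_inclExclPoly hP hQ hR hPQ hQR hRP
  have h2 := expandedBinary_mul R hu hv huv
  have hne : ∀ n : ℕ, 0 < n → (X ^ n - 1 : ℤ[X]) ≠ 0 := fun n hn => by
    simpa using X_pow_sub_C_ne_zero hn (1 : ℤ)
  have hg := geom_sum_mul (X : ℤ[X]) P
  have hX : (X - 1 : ℤ[X]) ≠ 0 := by simpa using hne 1 one_pos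
  refine mul_right_cancel₀ (mul_ne_zero (mul_ne_zero (hne _ (Nat.mul_pos hR hP))
    (hne _ (Nat.mul_pos hQ hR))) hX) ?_
  unfold inclExclDen inclExclNum at h
  linear_combination -h + (X ^ Q - 1) * (X ^ P - 1) * h2 -
    expandedBinary P Q R u v * (1 - X ^ Q) * ((X ^ (R * P) - 1) * (X ^ (Q * R) - 1)) * hg

theorem sum_sum_ite_eq_ite {a b α β x₀ y₀ : ℕ} {T : ℕ → ℕ → Prop} [∀ x y, Decidable (T x y)]
    (h : ∀ x < a, ∀ y < b, T x y → x + α = x₀ ∧ y + β = y₀) :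
    (∑ x ∈ Finset.range a, ∑ y ∈ Finset.range b, if T x y then (1 : ℤ) else 0) =
      if (α ≤ x₀ ∧ x₀ < a + α) ∧ (β ≤ y₀ ∧ y₀ < b + β) ∧ T (x₀ - α) (y₀ - β) then 1 else 0 := by
  split_ifs with hc
  · obtain ⟨⟨h1, h2⟩, ⟨h3, h4⟩, h5⟩ := hc
    rw [Finset.sum_eq_single (x₀ - α), Finset.sum_eq_single (y₀ - β), if_pos h5]
    · intro y hy hne
      rw [if_neg]
      intro hT
      have := h _ (by omega) y (Finset.mem_range.1 hy) hT
      omega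
    · intro hn
      exact absurd (Finset.mem_range.2 (by omega)) hn
    · intro x hx hne
      refine Finset.sum_eq_zero fun y hy => if_neg fun hT => ?_
      have := h x (Finset.mem_range.1 hx) y (Finset.mem_range.1 hy) hT
      omega
    · intro hn
      exact absurd (Finset.mem_range.2 (by omega)) hn
  · refine Finset.sum_eq_zero fun x hx => Finset.sum_eq_zero fun y hy => if_neg fun hT => hc ?_
    have hx := Finset.mem_range.1 hx
    have hy := Finset.mem_range.1 hy
    obtain ⟨rfl, rfl⟩ := h x hx y hy hT
    refine ⟨⟨by omega, by omega⟩, ⟨by omega, by omega⟩, by simpa using hT⟩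

theorem ite_le_sub_ite_le {N e n : ℤ} (hN : 0 < N) (he : 0 ≤ e) (h : N ∣ n - e) :
    ((if e ≤ n then 1 else 0) - (if N ≤ n then (if e ≤ n - N then 1 else 0) else 0) : ℤ) =
      if n = e then 1 else 0 := by
  obtain ⟨z, hz⟩ := h
  rcases lt_trichotomy z 0 with hz0 | rfl | hz0
  · have : N * z ≤ -N := by nlinarith
    split_ifs <;> omega
  · split_ifs <;> omega
  · have : N ≤ N * z := by nlinarith
    split_ifs <;> omega

theorem coords_eq_of_modEq {P Q R s : ℕ} (hRQ : R * Q ≡ 1 [MOD P]) (hs : R * s * P ≡ 1 [MOD Q])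
    {x y : ℕ} (hx : x < Q) (hy : y < P) {n : ℤ}
    (h : (P * Q : ℤ) ∣ n - ((x : ℤ) * P + y * Q) * R) :
    n * s % Q = x ∧ n % P = y := by
  have hRQ' := Int.natCast_modEq_iff.2 hRQ
  have hs' := Int.natCast_modEq_iff.2 hs
  push_cast at hRQ' hs'
  obtain ⟨z, hz⟩ := h
  obtain ⟨i, hi⟩ := hRQ'.symm.dvd
  obtain ⟨j, hj⟩ := hs'.symm.dvd
  have hn : n = ((x : ℤ) * P + y * Q) * R + P * Q * z := by linarith
  constructor
  · have : n * s ≡ x [ZMOD Q] :=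
      Int.modEq_iff_dvd.2 ⟨-(x * j + y * R * s + P * z * s), by
        rw [hn]; linear_combination (-(x : ℤ)) * hj⟩
    rw [this, Int.emod_eq_of_lt (by positivity) (by exact_mod_cast hx)]
  · have : n ≡ y [ZMOD P] :=
      Int.modEq_iff_dvd.2 ⟨-(y * i + x * R + Q * z), by
        rw [hn]; linear_combination (-(y : ℤ)) * hi⟩
    rw [this, Int.emod_eq_of_lt (by positivity) (by exact_mod_cast hy)]

theorem dvd_sub_coords {P Q R s : ℕ} (hPQ : P.Coprime Q) (hRQ : R * Q ≡ 1 [MOD P])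
    (hs : R * s * P ≡ 1 [MOD Q]) (n : ℤ) :
    (P * Q : ℤ) ∣ n - (n * s % Q * P + n % P * Q) * R := by
  have hRQ' := Int.natCast_modEq_iff.2 hRQ
  have hs' := Int.natCast_modEq_iff.2 hs
  push_cast at hRQ' hs'
  obtain ⟨i, hi⟩ := hRQ'.symm.dvd
  obtain ⟨j, hj⟩ := hs'.symm.dvd
  refine IsCoprime.mul_dvd (Nat.isCoprime_iff_coprime.2 hPQ) ?_ ?_
  · have := Int.emod_def n P
    exact ⟨-(n * s % Q * R + n * i - n / P * Q * R), by
      linear_combination (-Q * R : ℤ) * this - n * hi⟩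
  · have := Int.emod_def (n * s) Q
    exact ⟨-(n % P * R + n * j - n * s / Q * P * R), by
      linear_combination (-P * R : ℤ) * this - n * hj⟩

/-- Along a residue class modulo `PQ` the coordinates `(x, y)` are constant and the truncated sign
is a step function of `n`. Its difference over one period is a single spike, at the exponent of the
one monomial in that class. -/
theorem coeff_expandedBinary {P Q R u v s : ℕ} (hR : 0 < R) (hu : u ≤ Q) (hv : v ≤ P)
    (hP : 0 < P) (hQ : 0 < Q)
    (huv : u * P + v * Q = P * Q + 1) (hPQ : P.Coprime Q) (hRQ : R * Q ≡ 1 [MOD P])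
    (hs : R * s * P ≡ 1 [MOD Q]) (n : ℕ) :
    (expandedBinary P Q R u v).coeff n =
      residueSign P Q u v s ((n : ℤ) / R) n -
        if P * Q ≤ n then residueSign P Q u v s (((n - P * Q : ℕ) : ℤ) / R) (n - P * Q : ℕ)
        else 0 := by
  obtain ⟨x₀, hx₀⟩ : ∃ x₀ : ℕ, (n : ℤ) * s % Q = x₀ := ⟨n * s % Q, by push_cast; rfl⟩
  obtain ⟨y₀, hy₀⟩ : ∃ y₀ : ℕ, (n : ℤ) % P = y₀ := ⟨n % P, by push_cast; rfl⟩
  have hx₀Q : (x₀ : ℤ) < Q := hx₀ ▸ Int.emod_lt_of_pos _ (by exact_mod_cast hQ)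
  have hy₀P : (y₀ : ℤ) < P := hy₀ ▸ Int.emod_lt_of_pos _ (by exact_mod_cast hP)
  have hdvd := dvd_sub_coords hPQ hRQ hs n
  rw [hx₀, hy₀] at hdvd
  have huv' : (u : ℤ) * P + v * Q = P * Q + 1 := by exact_mod_cast huv
  have hN : (0 : ℤ) < P * Q := by exact_mod_cast Nat.mul_pos hP hQ
  have hRZ : (0 : ℤ) < R := by exact_mod_cast hR
  have hlift : ∀ x y : ℕ, x < Q → y < P →
      (P * Q : ℤ) ∣ n - ((x : ℤ) * P + y * Q) * R → x = x₀ ∧ y = y₀ := fun x y hx hy h => by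
    have := coords_eq_of_modEq hRQ hs hx hy h
    rw [hx₀, hy₀] at this
    exact ⟨by exact_mod_cast this.1.symm, by exact_mod_cast this.2.symm⟩
  unfold expandedBinary
  simp only [coeff_sub, finsetSum_coeff, coeff_X_pow]
  rw [sum_sum_ite_eq_ite (α := 0) (β := 0) (x₀ := x₀) (y₀ := y₀),
    sum_sum_ite_eq_ite (α := u) (β := v) (x₀ := x₀) (y₀ := y₀)]
  rotate_left
  · intro x hx y hy h
    refine hlift _ _ (by omega) (by omega) ⟨-R, ?_⟩
    rw [h]; push_cast
    linear_combination (-(R : ℤ)) * huv'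
  · intro x hx y hy h
    refine hlift _ _ (by omega) (by omega) ⟨0, ?_⟩
    rw [h]; push_cast; ring
  have hshift : P * Q ≤ n → residueSign P Q u v s (((n - P * Q : ℕ) : ℤ) / R) (n - P * Q : ℕ) =
      blockSign P Q u v (((n : ℤ) - P * Q) / R) x₀ y₀ := fun h => by
    unfold residueSign
    push_cast [Nat.cast_sub h]
    rw [show ((n : ℤ) - P * Q) * s = n * s + Q * (-(P * s)) by ring, Int.add_mul_emod_self_left,
      show ((n : ℤ) - P * Q) = n + P * (-Q) by ring, Int.add_mul_emod_self_left, hx₀, hy₀]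
  have hn0 : residueSign P Q u v s ((n : ℤ) / R) n = blockSign P Q u v ((n : ℤ) / R) x₀ y₀ := by
    unfold residueSign; rw [hx₀, hy₀]
  rw [hn0]
  have hcast : (P * Q ≤ n) ↔ ((P : ℤ) * Q ≤ n) := by exact_mod_cast Iff.rfl
  have hrhs : (if P * Q ≤ n then
      residueSign P Q u v s (((n - P * Q : ℕ) : ℤ) / R) (n - P * Q : ℕ) else 0) =
      if (P : ℤ) * Q ≤ n then blockSign P Q u v (((n : ℤ) - P * Q) / R) x₀ y₀ else 0 := by
    by_cases h : P * Q ≤ n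
    · rw [if_pos h, if_pos (hcast.1 h), hshift h]
    · rw [if_neg h, if_neg (mt hcast.2 h)]
  rw [hrhs]
  have hle1 : ∀ m : ℤ, ((x₀ : ℤ) * P + y₀ * Q ≤ m / R) ↔ ((x₀ : ℤ) * P + y₀ * Q) * R ≤ m :=
    fun m => Int.le_ediv_iff_mul_le hRZ
  have hle2 : ∀ m : ℤ, ((x₀ : ℤ) * P + y₀ * Q ≤ m / R + P * Q) ↔
      ((x₀ : ℤ) * P + y₀ * Q - P * Q) * R ≤ m := fun m => by
    rw [← Int.le_ediv_iff_mul_le hRZ]; omega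
  unfold blockSign
  simp only [hle1, hle2]
  by_cases hA : x₀ < u ∧ y₀ < v
  · have hxu : (x₀ : ℤ) < u := by exact_mod_cast hA.1
    have hyv : (y₀ : ℤ) < v := by exact_mod_cast hA.2
    have hxu' : ¬ (u : ℤ) ≤ x₀ := not_le.2 hxu
    have hxu'' : ¬ u ≤ x₀ := not_le.2 hA.1
    simp only [hxu, hyv, hxu', hxu'', hA.1, hA.2, true_and, false_and, if_false, and_true,
      zero_le, add_zero, sub_zero, Nat.sub_zero]
    rw [ite_le_sub_ite_le hN (by positivity) hdvd]
    refine if_congr ?_ rfl rfl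
    rw [← Int.natCast_inj]; push_cast; rfl
  by_cases hB : u ≤ x₀ ∧ v ≤ y₀
  · have hxu : (u : ℤ) ≤ x₀ := by exact_mod_cast hB.1
    have hyv : (v : ℤ) ≤ y₀ := by exact_mod_cast hB.2
    have hxu' : ¬ (x₀ : ℤ) < u := not_lt.2 hxu
    have hxu'' : ¬ x₀ < u := not_lt.2 hB.1
    have hx2 : x₀ < Q - u + u := by omega
    have hy2 : y₀ < P - v + v := by omega
    have hpos : (0 : ℤ) ≤ ((x₀ : ℤ) * P + y₀ * Q - P * Q) * R := by
      refine mul_nonneg ?_ hRZ.le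
      nlinarith [mul_le_mul_of_nonneg_right hxu (by positivity : (0 : ℤ) ≤ P),
        mul_le_mul_of_nonneg_right hyv (by positivity : (0 : ℤ) ≤ Q)]
    have hd2 : (P * Q : ℤ) ∣ n - ((x₀ : ℤ) * P + y₀ * Q - P * Q) * R := by
      obtain ⟨z, hz⟩ := hdvd
      exact ⟨z + R, by linear_combination hz⟩
    have hkey := ite_le_sub_ite_le hN hpos hd2
    simp only [hxu, hyv, hxu', hxu'', hB.1, hB.2, hx2, hy2, true_and, false_and,
      and_false, add_zero, if_false]
    have hc : (n = (1 + (x₀ - u) * P + (y₀ - v) * Q) * R) ↔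
        ((n : ℤ) = ((x₀ : ℤ) * P + y₀ * Q - P * Q) * R) := by
      rw [← Int.natCast_inj]
      push_cast [Nat.cast_sub hB.1, Nat.cast_sub hB.2]
      have : 1 + ((x₀ : ℤ) - u) * P + (y₀ - v) * Q = (x₀ : ℤ) * P + y₀ * Q - P * Q := by
        linear_combination -huv'
      rw [this]
    rw [if_congr hc rfl rfl, ← hkey]
    split_ifs <;> simp
  · have hA' : ¬ ((x₀ : ℤ) < u ∧ (y₀ : ℤ) < v) := by exact_mod_cast hA
    have hB' : ¬ ((u : ℤ) ≤ x₀ ∧ (v : ℤ) ≤ y₀) := by exact_mod_cast hB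
    simp only [← and_assoc, hA', hB', false_and, if_false, ite_self, sub_zero]
    rw [if_neg, if_neg, sub_zero]
    · rintro ⟨⟨⟨⟨h1, -⟩, h2⟩, -⟩, -⟩; exact hB ⟨h1, h2⟩
    · rintro ⟨⟨⟨⟨-, h1⟩, -⟩, h2⟩, -⟩; exact hA ⟨by omega, by omega⟩

theorem coeff_inclExclPoly {P Q R u v s : ℕ} (hP : 0 < P) (hQ : 0 < Q) (hR : 0 < R)
    (hPQ : P.Coprime Q) (hQR : Q.Coprime R) (hRP : R.Coprime P) (hu : u ≤ Q) (hv : v ≤ P)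
    (huv : u * P + v * Q = P * Q + 1) (hRQ : R * Q ≡ 1 [MOD P])
    (hs : R * s * P ≡ 1 [MOD Q]) {n : ℕ} (hn : P + Q ≤ n) :
    (inclExclPoly P Q R).coeff n = ∑ j ∈ Finset.range P,
      (residueSign P Q u v s (((n - j : ℕ) : ℤ) / R) (n - j : ℕ) -
        residueSign P Q u v s (((n - j - Q : ℕ) : ℤ) / R) (n - j - Q : ℕ)) := by
  -- `D` is the power series quotient of `expandedBinary` by `1 - X ^ (P * Q)`.
  set D : PowerSeries ℤ := PowerSeries.mk fun n => residueSign P Q u v s ((n : ℤ) / R) n with hD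
  have h1 : D * (1 - PowerSeries.X ^ (P * Q)) = (expandedBinary P Q R u v : PowerSeries ℤ) := by
    ext n
    rw [Polynomial.coeff_coe, coeff_expandedBinary hR hu hv hP hQ huv hPQ hRQ hs, mul_sub, mul_one,
      map_sub, PowerSeries.coeff_mul_X_pow', hD]
    simp only [PowerSeries.coeff_mk]
  have h2 := congrArg (Polynomial.toPowerSeries) (inclExclPoly_mul hP hQ hR hPQ hQR hRP hu hv huv)
  have h3 : (inclExclPoly P Q R : PowerSeries ℤ) =
      ∑ j ∈ Finset.range P, (D - D * PowerSeries.X ^ Q) * PowerSeries.X ^ j := by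
    have hne : (1 - PowerSeries.X ^ (P * Q) : PowerSeries ℤ) ≠ 0 := by
      intro h
      have := congrArg (PowerSeries.coeff 0) h
      rw [map_sub, PowerSeries.coeff_X_pow, if_neg (Nat.mul_pos hP hQ).ne] at this
      simp at this
    refine mul_right_cancel₀ hne ?_
    have h2' : (inclExclPoly P Q R : PowerSeries ℤ) * (1 - PowerSeries.X ^ (P * Q)) =
        (expandedBinary P Q R u v : PowerSeries ℤ) * (1 - PowerSeries.X ^ Q) *
          ∑ j ∈ Finset.range P, PowerSeries.X ^ j := by
      have hsum : ((∑ j ∈ Finset.range P, X ^ j : ℤ[X]) : PowerSeries ℤ) =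
          ∑ j ∈ Finset.range P, PowerSeries.X ^ j := by
        rw [← Polynomial.coeToPowerSeries.ringHom_apply, map_sum]
        simp
      simpa [hsum] using h2
    rw [h2', ← h1, ← Finset.mul_sum]
    ring
  rw [← Polynomial.coeff_coe, h3, map_sum]
  refine Finset.sum_congr rfl fun j hj => ?_
  have hj := Finset.mem_range.1 hj
  rw [PowerSeries.coeff_mul_X_pow', if_pos (by omega), map_sub, PowerSeries.coeff_mul_X_pow',
    if_pos (by omega), hD]
  simp only [PowerSeries.coeff_mk]

/-! ### Window sums: periodicity and jumps -/

theorem blockSign_le_one (P Q u v K x y : ℤ) : blockSign P Q u v K x y ≤ 1 := by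
  unfold blockSign; split_ifs <;> norm_num

theorem blockSign_nonpos {u x : ℤ} (h : u ≤ x) (P Q v K y : ℤ) :
    blockSign P Q u v K x y ≤ 0 := by
  unfold blockSign
  rw [if_neg (by omega)]; split_ifs <;> norm_num

theorem exists_eq_of_sub_le_one {f : ℕ → ℤ} {m n : ℕ} {t : ℤ} (hmn : m ≤ n) (hm : t ≤ f m)
    (hn : f n ≤ t) (h : ∀ i, m ≤ i → i < n → f i - f (i + 1) ≤ 1) :
    ∃ i, i ≤ n ∧ f i = t := by
  induction n, hmn using Nat.le_induction with
  | base => exact ⟨m, le_rfl, by omega⟩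
  | succ n hmn ih =>
    rcases le_or_gt (f n) t with h1 | h1
    · obtain ⟨i, hi, hf⟩ := ih h1 fun i h1 h2 => h i h1 (by omega)
      exact ⟨i, by omega, hf⟩
    · exact ⟨n + 1, le_rfl, by have := h n hmn (by omega); omega⟩

/-- A difference of window sums of `residueSign`: the coefficient of `X ^ m` in the ternary
polynomial for `m` in the `K`-th interval of length `R`. -/
def windowSum (P : ℕ) (Q u v s K m : ℤ) : ℤ :=
  ∑ j ∈ Finset.range P, (residueSign P Q u v s K (m - j) - residueSign P Q u v s K (m - j - Q))

theorem coeff_inclExclPoly_eq_windowSum {P Q R u v s K : ℕ} (hP : 0 < P) (hQ : 0 < Q) (hR : 0 < R)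
    (hPQ : P.Coprime Q) (hQR : Q.Coprime R) (hRP : R.Coprime P) (hu : u ≤ Q) (hv : v ≤ P)
    (huv : u * P + v * Q = P * Q + 1) (hRQ : R * Q ≡ 1 [MOD P])
    (hs : R * s * P ≡ 1 [MOD Q]) {n : ℕ} (hn : K * R + P + Q ≤ n) (hn' : n < (K + 1) * R) :
    (inclExclPoly P Q R).coeff n = windowSum P Q u v s K n := by
  rw [coeff_inclExclPoly hP hQ hR hPQ hQR hRP hu hv huv hRQ hs (by omega), windowSum]
  have hdiv : ∀ m : ℕ, K * R ≤ m → m ≤ n → (m : ℤ) / R = K := fun m h1 h2 => by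
    rw [← Int.natCast_ediv, Nat.div_eq_of_lt_le h1 (by omega)]
  refine Finset.sum_congr rfl fun j hj => ?_
  have hj := Finset.mem_range.1 hj
  rw [hdiv _ (by omega) (by omega), hdiv _ (by omega) (by omega)]
  have h1 : ((n - j : ℕ) : ℤ) = n - j := Nat.cast_sub (by omega)
  have h2 : ((n - j - Q : ℕ) : ℤ) = n - j - Q := by rw [Nat.cast_sub (by omega), h1]
  rw [h2, h1]

theorem residueSign_add_mul (P Q u v s K m T : ℤ) :
    residueSign P Q u v s K (m + P * Q * T) = residueSign P Q u v s K m := by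
  unfold residueSign
  rw [show (m + P * Q * T) * s = m * s + Q * (P * T * s) by ring, Int.add_mul_emod_self_left,
    show m + P * Q * T = m + P * (Q * T) by ring, Int.add_mul_emod_self_left]

theorem windowSum_add_mul (P : ℕ) (Q u v s K m T : ℤ) :
    windowSum P Q u v s K (m + P * Q * T) = windowSum P Q u v s K m := by
  refine Finset.sum_congr rfl fun j _ => ?_
  rw [← residueSign_add_mul P Q u v s K (m - j) T, ← residueSign_add_mul P Q u v s K (m - j - Q) T]
  congr 2 <;> ring

/-- Telescoping leaves four signs. Shifting by `Q` preserves the first coordinate and shifting by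
`P` the second, so they sit at the corners of a rectangle and `abs_blockSign_sub_le` applies. -/
theorem abs_windowSum_sub_le (P : ℕ) (Q u v s K m : ℤ) :
    |windowSum P Q u v s K (m + 1) - windowSum P Q u v s K m| ≤ 1 := by
  have h : windowSum P Q u v s K (m + 1) - windowSum P Q u v s K m =
      (residueSign P Q u v s K (m + 1) - residueSign P Q u v s K (m + 1 - Q)) -
      (residueSign P Q u v s K (m + 1 - P) - residueSign P Q u v s K (m + 1 - P - Q)) := by
    unfold windowSum
    rw [← Finset.sum_sub_distrib]
    have := Finset.sum_range_sub' (fun j : ℕ => residueSign P Q u v s K (m + 1 - j) -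
      residueSign P Q u v s K (m + 1 - j - Q)) P
    simp only [Nat.cast_zero, sub_zero] at this
    rw [← this]
    refine Finset.sum_congr rfl fun j _ => ?_
    push_cast
    congr 3 <;> ring
  rw [h]
  unfold residueSign
  have e1 : (m + 1 - Q) * s % Q = (m + 1) * s % Q := by
    rw [show (m + 1 - Q) * s = (m + 1) * s + Q * (-s) by ring, Int.add_mul_emod_self_left]
  have e2 : (m + 1 - P - Q) * s % Q = (m + 1 - P) * s % Q := by
    rw [show (m + 1 - P - Q) * s = (m + 1 - P) * s + Q * (-s) by ring, Int.add_mul_emod_self_left]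
  have e3 : (m + 1 - P) % P = (m + 1) % P := by
    rw [show m + 1 - P = m + 1 + P * (-1 : ℤ) by ring, Int.add_mul_emod_self_left]
  have e4 : (m + 1 - P - Q) % P = (m + 1 - Q) % P := by
    rw [show m + 1 - P - Q = m + 1 - Q + P * (-1 : ℤ) by ring, Int.add_mul_emod_self_left]
  rw [e1, e2, e3, e4]
  refine le_trans (le_of_eq ?_) (abs_blockSign_sub_le P Q u v K ((m + 1) * s % Q) ((m + 1) % P)
    ((m + 1 - P) * s % Q) ((m + 1 - Q) % P))
  congr 1; ring

/-! ### Window sums of size at least `v - 2` -/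

section Extremes

variable {P : ℕ} {Q u v s : ℤ} (hP : 2 < P) (hs : 0 < s) (hv : 2 ≤ v) (hvP : 2 * v ≤ P + 2)
  (hsQ : s * P * P < Q) (huv : u * P + v * Q = P * Q + 1)

include hP hs hv hvP hsQ huv

/-- Smallness of `s` gives `m * s < Q / P`, while `u > Q / P` because `v ≤ P - 1`. -/
theorem emod_eq_and_lt {m : ℤ} (h0 : 0 ≤ m) (hm : m < v) : m * s % Q = m * s ∧ m * s < u := by
  have hmP : m < P := by omega
  have h1 : m * s * P < Q := by
    have : m * s * P ≤ P * s * P := by gcongr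
    linarith [mul_comm s (P : ℤ)]
  have h2 : 0 ≤ m * s := mul_nonneg h0 hs.le
  have hQ : 0 < Q := by nlinarith
  refine ⟨Int.emod_eq_of_lt h2 (by nlinarith), ?_⟩
  have h3 : v + 1 ≤ P := by omega
  have h4 : Q + 1 ≤ u * P := by nlinarith
  by_contra! hcon
  have : u * P ≤ m * s * P := by gcongr
  omega

omit hvP in
theorem emod_eq_and_le {i : ℤ} (h0 : 0 < i) (hi : i ≤ P) :
    -i * s % Q = Q - i * s ∧ u ≤ Q - i * s := by
  have h1 : i * s * P < Q := by
    have : i * s * P ≤ P * s * P := by gcongr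
    linarith [mul_comm s (P : ℤ)]
  have h2 : 0 < i * s := mul_pos h0 hs
  have h3 : i * s < Q := by nlinarith
  refine ⟨?_, ?_⟩
  · rw [show -i * s = Q - i * s + Q * (-1) by ring, Int.add_mul_emod_self_left,
      Int.emod_eq_of_lt (by omega) (by omega)]
  · by_contra! hcon
    have h4 : (Q - i * s + 1) * P ≤ u * P := by gcongr; omega
    have h5 : 2 * Q ≤ v * Q := by gcongr; omega
    nlinarith

/-- The point of `m` is `(m * s, m)`, of degree `m * (s * P + Q)`; the truncation degree is exactly
that of the last point, `m = v - 1`. -/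
theorem residueSign_eq_one {m : ℤ} (h0 : 0 ≤ m) (hm : m < v) :
    residueSign P Q u v s ((v - 1) * (s * P + Q)) m = 1 := by
  obtain ⟨h1, h2⟩ := emod_eq_and_lt hP hs hv hvP hsQ huv h0 hm
  unfold residueSign blockSign
  rw [h1, Int.emod_eq_of_lt h0 (by omega), if_pos]
  refine ⟨h2, hm, ?_⟩
  have hQ : 0 < s * P + Q := by
    have : 0 ≤ s * P := by positivity
    have : 0 ≤ s * P * P := by positivity
    omega
  calc m * s * P + m * Q = m * (s * P + Q) := by ring
    _ ≤ _ := by gcongr; omega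

omit hvP in
-- A sign `-1` would need `P * Q ≤ (v - 1 + i) * (s * P + Q)`, but the right side is at most `(P -
-- 1) * (s * P + Q) < P * Q`, since `s * P * P < Q`.
theorem residueSign_neg_eq_zero {i : ℤ} (h0 : 0 < i) (hi : i ≤ P - v) :
    residueSign P Q u v s ((v - 1) * (s * P + Q)) (-i) = 0 := by
  obtain ⟨h1, h2⟩ := emod_eq_and_le hP hs hv hsQ huv h0 (by omega)
  unfold residueSign blockSign
  have hy : -i % (P : ℤ) = P - i := by
    rw [show -i = (P : ℤ) - i + P * (-1) by ring, Int.add_mul_emod_self_left,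
      Int.emod_eq_of_lt (by omega) (by omega)]
  rw [h1, hy, if_neg (by omega), if_neg]
  rintro ⟨-, -, h⟩
  have hW : 0 < s * P + Q := by
    have : 0 ≤ s * P := by positivity
    have : 0 ≤ s * P * P := by positivity
    omega
  have h3 : (v - 1 + i) * (s * P + Q) ≤ (P - 1) * (s * P + Q) := by gcongr; omega
  have h4 : 0 ≤ s * P := by positivity
  nlinarith

theorem residueSign_eq_zero {m : ℤ} (h0 : 0 ≤ m) (hm : m < v) {m' y : ℤ} (K : ℤ)
    (hx : m' * s % Q = m * s % Q) (hy : m' ≡ y [ZMOD P]) (hvy : v ≤ y) (hyP : y < P) :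
    residueSign P Q u v s K m' = 0 := by
  obtain ⟨h1, h2⟩ := emod_eq_and_lt hP hs hv hvP hsQ huv h0 hm
  unfold residueSign blockSign
  have hy' : m' % P = y := by rw [hy, Int.emod_eq_of_lt (by omega) hyP]
  rw [hx, h1, hy', if_neg (by omega), if_neg (by omega)]

/-- Subtracting `Q` keeps `x` and moves `y = m` to `m + v - 2`, which lies in `[v, P)` for `2 ≤ m <
v`; there the sign is 0. The indices `m = 0, 1` and the negative ones contribute at least 0. -/
theorem le_windowSum (hQv : Q + v ≡ 2 [ZMOD P]) :
    v - 2 ≤ windowSum P Q u v s ((v - 1) * (s * P + Q)) (v - 1) := by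
  set K := (v - 1) * (s * P + Q)
  have key : ∀ j ∈ Finset.range P, (if (j : ℤ) + 3 ≤ v then 1 else 0) ≤
      residueSign P Q u v s K (v - 1 - j) - residueSign P Q u v s K (v - 1 - j - Q) := by
    intro j hj
    have hj := Finset.mem_range.1 hj
    obtain ⟨m, hm⟩ : ∃ m, m = v - 1 - (j : ℤ) := ⟨_, rfl⟩
    rw [← hm]
    have hx : (m - Q) * s % Q = m * s % Q := by
      rw [show (m - Q) * s = m * s + Q * (-s) by ring, Int.add_mul_emod_self_left]
    rcases lt_or_ge m 0 with hneg | hnn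
    · rw [if_neg (by omega)]
      have h1 := residueSign_neg_eq_zero hP hs hv hsQ huv (i := -m) (by omega) (by omega)
      rw [neg_neg] at h1
      obtain ⟨h2, h3⟩ := emod_eq_and_le hP hs hv hsQ huv (i := -m) (by omega) (by omega)
      rw [neg_neg] at h2
      have h4 : residueSign P Q u v s K (m - Q) ≤ 0 := by
        unfold residueSign
        rw [hx, h2]
        exact blockSign_nonpos h3 _ _ _ _ _
      rw [h1]; omega
    · rw [residueSign_eq_one hP hs hv hvP hsQ huv hnn (by omega)]
      have h4 : residueSign P Q u v s K (m - Q) ≤ 1 := blockSign_le_one _ _ _ _ _ _ _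
      split_ifs with h
      · rw [residueSign_eq_zero hP hs hv hvP hsQ huv hnn (by omega) K hx (y := m + v - 2) ?_
          (by omega) (by omega)]
        · simp
        · have := hQv.symm.add_left (m - 2 - Q)
          ring_nf at this ⊢
          exact this
      · omega
  refine le_trans (le_of_eq ?_) (Finset.sum_le_sum key)
  rw [Finset.sum_boole]
  have : (Finset.range P).filter (fun j : ℕ => (j : ℤ) + 3 ≤ v) = Finset.range (v - 2).toNat := by
    ext j; simp only [Finset.mem_filter, Finset.mem_range]; omega
  rw [this, Finset.card_range]; omega

/-- Mirror image of `le_windowSum`: adding `Q` moves `y = m` to `m + 2 - v + P`, in `[v, P)` for `0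
≤ m ≤ v - 3`. -/
theorem windowSum_le (hQv : Q + v ≡ 2 [ZMOD P]) :
    windowSum P Q u v s ((v - 1) * (s * P + Q)) (v - 1 + Q) ≤ -(v - 2) := by
  set K := (v - 1) * (s * P + Q)
  have key : ∀ j ∈ Finset.range P, residueSign P Q u v s K (v - 1 + Q - j) -
      residueSign P Q u v s K (v - 1 + Q - j - Q) ≤
      -(if 2 ≤ (j : ℤ) ∧ (j : ℤ) < v then 1 else 0) := by
    intro j hj
    have hj := Finset.mem_range.1 hj
    obtain ⟨m, hm⟩ : ∃ m, m = v - 1 - (j : ℤ) := ⟨_, rfl⟩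
    rw [show v - 1 + Q - (j : ℤ) - Q = m by omega, show v - 1 + Q - (j : ℤ) = m + Q by omega]
    have hx : (m + Q) * s % Q = m * s % Q := by
      rw [add_mul, Int.add_mul_emod_self_left]
    rcases lt_or_ge m 0 with hneg | hnn
    · rw [if_neg (by omega)]
      have h1 := residueSign_neg_eq_zero hP hs hv hsQ huv (i := -m) (by omega) (by omega)
      rw [neg_neg] at h1
      obtain ⟨h2, h3⟩ := emod_eq_and_le hP hs hv hsQ huv (i := -m) (by omega) (by omega)
      rw [neg_neg] at h2
      have h4 : residueSign P Q u v s K (m + Q) ≤ 0 := by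
        unfold residueSign
        rw [hx, h2]
        exact blockSign_nonpos h3 _ _ _ _ _
      rw [h1]; omega
    · rw [residueSign_eq_one hP hs hv hvP hsQ huv hnn (by omega)]
      have h4 : residueSign P Q u v s K (m + Q) ≤ 1 := blockSign_le_one _ _ _ _ _ _ _
      split_ifs with h
      · rw [residueSign_eq_zero hP hs hv hvP hsQ huv hnn (by omega) K hx (y := m + 2 - v + P) ?_
          (by omega) (by omega)]
        · simp
        · have := (hQv.add_left (m - v)).trans
            (Int.modEq_iff_dvd.2 ⟨1, by ring⟩ : m - v + 2 ≡ m + 2 - v + P [ZMOD P])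
          ring_nf at this ⊢
          exact this
      · omega
  refine (Finset.sum_le_sum key).trans (le_of_eq ?_)
  rw [Finset.sum_neg_distrib, Finset.sum_boole]
  have : (Finset.range P).filter (fun j : ℕ => 2 ≤ (j : ℤ) ∧ (j : ℤ) < v) =
      Finset.Ico 2 v.toNat := by
    ext j; simp only [Finset.mem_filter, Finset.mem_range, Finset.mem_Ico]; omega
  rw [this, Nat.card_Ico]; omega

end Extremes

/-! ### All intermediate coefficients -/

theorem mem_coeffSet_inclExclPoly {P Q R v s : ℕ} (hP : 2 < P) (hs : 0 < s) (hv : 3 ≤ v)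
    (hvP : 2 * v ≤ P + 2) (hsQ : s * P * P < Q) (hR : 5 * (P * Q) < R)
    (hPQ : P.Coprime Q) (hQR : Q.Coprime R) (hRP : R.Coprime P)
    (hQv : Q + v ≡ 2 [MOD P]) (hvQ : v * Q ≡ 1 [MOD P]) (hRQ : R * Q ≡ 1 [MOD P])
    (hsR : R * s * P ≡ 1 [MOD Q]) {n : ℤ} (hn : |n| ≤ v - 2) :
    n ∈ coeffSet (inclExclPoly P Q R) := by
  have hQ : 0 < Q := by omega
  have hPQpos : 0 < P * Q := Nat.mul_pos (by omega) hQ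
  have hvQ1 : 1 ≤ v * Q := Nat.mul_pos (by omega) hQ
  have hvQle : v * Q ≤ P * Q := Nat.mul_le_mul_right _ (by omega)
  obtain ⟨i, hi⟩ := (Nat.modEq_iff_dvd' hvQ1).1 hvQ.symm
  have hiQ : i ≤ Q := by
    by_contra! h
    have : P * Q ≤ P * i := Nat.mul_le_mul_left _ h.le
    omega
  obtain ⟨u, hQu⟩ := Nat.exists_eq_add_of_le hiQ
  have huv : u * P + v * Q = P * Q + 1 := by
    have : P * Q = P * i + u * P := by rw [hQu]; ring
    omega
  set K := (v - 1) * (s * P + Q) with hK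
  have hKZ : (K : ℤ) = (v - 1) * (s * P + Q) := by
    rw [hK]; push_cast [Nat.cast_sub (show 1 ≤ v by omega)]; ring
  have huvZ : (u : ℤ) * P + v * Q = P * Q + 1 := by exact_mod_cast huv
  have hsQZ : (s : ℤ) * P * P < Q := by exact_mod_cast hsQ
  have hQvZ : (Q : ℤ) + v ≡ 2 [ZMOD P] := by exact_mod_cast Int.natCast_modEq_iff.2 hQv
  have hmax := le_windowSum (s := s) hP (by exact_mod_cast hs) (by omega) (by omega) hsQZ huvZ hQvZ
  have hmin := windowSum_le (s := s) hP (by exact_mod_cast hs) (by omega) (by omega) hsQZ huvZ hQvZ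
  rw [← hKZ] at hmax hmin
  -- Translating by this multiple of the period brings both extremal indices into the `K`-th
  -- interval of length `R`; `5 * (P * Q) < R` leaves room.
  obtain ⟨T, hT1, hT2⟩ : ∃ T : ℕ, K * R + P + Q ≤ P * Q * T ∧
      P * Q * T ≤ K * R + P + Q + P * Q := by
    refine ⟨(K * R + P + Q) / (P * Q) + 1, (Nat.lt_mul_div_succ _ hPQpos).le, ?_⟩
    have := Nat.mul_div_le (K * R + P + Q) (P * Q)
    rw [Nat.mul_add]; omega
  have hb1 : 2 * Q ≤ P * Q := Nat.mul_le_mul_right _ (by omega)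
  have hPs : P ≤ s * P * P := Nat.le_mul_of_pos_left P (Nat.mul_pos hs (by omega))
  have hb2 : P * 2 ≤ P * Q := Nat.mul_le_mul_left _ (by omega)
  have hb3 : (K + 1) * R = K * R + R := by ring
  have hcoeff : ∀ m, v - 1 + P * Q * T ≤ m → m ≤ v - 1 + P * Q * T + Q →
      (inclExclPoly P Q R).coeff m = windowSum P Q u v s K m := fun m h1 h2 =>
    coeff_inclExclPoly_eq_windowSum (by omega) hQ (by omega) hPQ hQR hRP (by omega) (by omega) huv
      hRQ hsR (by omega) (by omega)
  have hcast : ((v - 1 + P * Q * T : ℕ) : ℤ) = v - 1 + P * Q * T := by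
    push_cast [Nat.cast_sub (show 1 ≤ v by omega)]; ring
  have hstart : (v : ℤ) - 2 ≤ (inclExclPoly P Q R).coeff (v - 1 + P * Q * T) := by
    rw [hcoeff _ le_rfl (by omega), hcast, windowSum_add_mul]
    exact hmax
  have hend : (inclExclPoly P Q R).coeff (v - 1 + P * Q * T + Q) ≤ -((v : ℤ) - 2) := by
    rw [hcoeff _ (by omega) le_rfl, Nat.cast_add, hcast,
      show (v : ℤ) - 1 + P * Q * T + Q = v - 1 + Q + P * Q * T by ring, windowSum_add_mul]
    exact hmin
  have hn' := abs_le.1 hn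
  obtain ⟨m, hm, hmn⟩ := exists_eq_of_sub_le_one (f := (inclExclPoly P Q R).coeff) (t := n)
    (Nat.le_add_right (v - 1 + P * Q * T) Q) (by omega) (by omega) fun j h1 h2 => by
      rw [hcoeff j h1 h2.le, hcoeff (j + 1) (by omega) (by omega)]
      have := abs_le.1 (abs_windowSum_sub_le P Q u v s K j)
      push_cast; omega
  -- The degree bound comes from the right endpoint, whose coefficient is negative as `v ≥ 3`; this
  -- covers `n = 0` too.
  exact ⟨m, hm.trans (le_natDegree_of_ne_zero (by omega)), hmn⟩

/-! ### Choice of the exponents -/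

theorem exists_pow_pow_coeffSet {p q r : ℕ} (hp : p.Prime) (hq : q.Prime) (hr : r.Prime)
    (hpq : p ≠ q) (hqr : q ≠ r) (hrp : r ≠ p) :
    ∃ k : ℕ, ∀ e m : ℕ, k ≤ e → 2 ≤ e → 1 ≤ m → m ≤ e → ∃ b c : ℕ, 2 < q ^ b ∧ 2 < r ^ c ∧
      ∀ n : ℤ, |n| ≤ (p ^ e * (p ^ m / 2) : ℕ) - 1 →
        n ∈ coeffSet (unitaryCyclotomic p (e + m) q b r c) := by
  have cop : ∀ {x y : ℕ}, x.Prime → y.Prime → x ≠ y → x.Coprime y := fun hx hy h =>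
    (Nat.coprime_primes hx hy).2 h
  obtain ⟨k₁, l₁, hk₁⟩ := exists_pow_modEq_modEq hp hr hrp.symm hq.one_lt (cop hp hq hpq)
    (cop hr hq hqr.symm)
  obtain ⟨k₂, l, hk₂⟩ := exists_pow_modEq_modEq hp hq hpq hr.one_lt (cop hp hr hrp.symm)
    (cop hq hr hqr)
  refine ⟨max k₁ k₂, fun e m hke he hm hme => ?_⟩
  have hp2 := hp.two_le
  set P := p ^ (e + m) with hPdef
  have hPe : P = p ^ e * p ^ m := pow_add p e m
  have hpe4 : 4 ≤ p ^ e := by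
    calc 4 = 2 ^ 2 := rfl
      _ ≤ p ^ 2 := Nat.pow_le_pow_left hp2 2
      _ ≤ p ^ e := Nat.pow_le_pow_right hp.pos he
  have hpm2 : 2 ≤ p ^ m := hp2.trans (Nat.le_self_pow (by omega) p)
  have hP2 : 2 < P := by rw [hPe]; nlinarith
  obtain ⟨f, hf⟩ : ∃ f, f = p ^ m / 2 := ⟨_, rfl⟩
  obtain ⟨g, hg⟩ : ∃ g, f + g = p ^ m := ⟨p ^ m - f, by omega⟩
  have hfg : f ≤ g := by omega
  have hf1 : 1 ≤ f := by omega
  set v := 1 + p ^ e * f with hvdef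
  set w := 1 + p ^ e * g with hwdef
  have hvw : v + w = P + 2 := by rw [hPe, ← hg]; ring
  have hvw1 : w * v ≡ 1 [MOD P] := by
    -- Here `m ≤ e` is needed: it makes `p ^ (2 * e)` a multiple of `P`.
    have : w * v = 1 + P * (1 + p ^ (e - m) * (f * g)) := by
      have h1 : p ^ e = p ^ m * p ^ (e - m) := by rw [← pow_add, Nat.add_sub_cancel' hme]
      calc w * v = 1 + p ^ e * (f + g) + p ^ e * p ^ e * (f * g) := by rw [hvdef, hwdef]; ring
        _ = 1 + P + p ^ e * (p ^ m * p ^ (e - m)) * (f * g) := by rw [hg, ← hPe, ← h1]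
        _ = _ := by rw [hPe]; ring
    rw [this]
    simp [Nat.ModEq]
  have one_mod : ∀ x k : ℕ, k ≤ e → ((1 + p ^ e * x : ℕ) : ℤ) ≡ 1 [ZMOD (p : ℤ) ^ k] :=
    fun x k h => Int.modEq_iff_dvd.2 (by
      push_cast
      exact (pow_dvd_pow (p : ℤ) h).trans ⟨-x, by ring⟩)
  -- Fixing `s` before `Q` lets `Q` exceed `s * P * P`. Inverting `P` modulo a fixed power of `q`
  -- forces the later residue `t` of `R` to be 1 modulo `q ^ l`. The exponent is `l + 1` so that the
  -- modulus exceeds 1.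
  obtain ⟨s, -, hs⟩ := Nat.exists_mul_mod_eq_one_of_coprime (k := q ^ (l + 1)) (n := P)
    ((cop hp hq hpq).pow _ _) (Nat.one_lt_pow (by omega) hq.one_lt)
  have hs0 : 0 < s := by
    rcases Nat.eq_zero_or_pos s with rfl | h
    · simp at hs
    · exact h
  -- Only the residue modulo `P` matters here; the condition modulo `r ^ 0` is vacuous.
  obtain ⟨b, hbB, hb, -⟩ := hk₁ (e + m) 0 w 1 (one_mod g k₁ (by omega)) rfl (l + 1 + s * P * P)
  set Q := q ^ b with hQdef
  have hbQ : b < Q := Nat.lt_pow_self hq.one_lt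
  have hsq : s.Coprime q := by
    refine Nat.Coprime.symm ((Nat.Prime.coprime_iff_not_dvd hq).2 fun hd => ?_)
    have h1 : q ∣ P * s % q ^ (l + 1) :=
      (Nat.dvd_mod_iff (dvd_pow_self q (by omega))).2 (Dvd.dvd.mul_left hd P)
    rw [hs] at h1
    exact hq.one_lt.ne' (Nat.dvd_one.1 h1)
  obtain ⟨t, -, ht⟩ := Nat.exists_mul_mod_eq_one_of_coprime (k := Q) (n := P * s)
    (Nat.Coprime.mul_left ((cop hp hq hpq).pow _ _) (hsq.pow_right b)) (by omega)
  have ht1 : (t : ℤ) ≡ 1 [ZMOD (q : ℤ) ^ l] := by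
    have hQ1 : 1 < Q := by omega
    have hl1 : 1 < q ^ (l + 1) := Nat.one_lt_pow (by omega) hq.one_lt
    have h1 : P * s * t ≡ 1 [MOD q ^ (l + 1)] :=
      Nat.ModEq.of_dvd (pow_dvd_pow q (by omega : l + 1 ≤ b))
        (by rw [Nat.ModEq, Nat.mod_eq_of_lt (a := 1) hQ1]; exact ht)
    have h2 : P * s ≡ 1 [MOD q ^ (l + 1)] := by
      rw [Nat.ModEq, Nat.mod_eq_of_lt (a := 1) hl1]; exact hs
    have h3 : t ≡ 1 [MOD q ^ (l + 1)] := by simpa using (h2.mul_right t).symm.trans h1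
    have := Int.natCast_modEq_iff.2 (h3.of_dvd (pow_dvd_pow q (Nat.le_succ l)))
    simpa using this
  obtain ⟨c, hcB, hc, hc'⟩ := hk₂ (e + m) b v t (one_mod f k₂ (by omega)) ht1 (5 * (P * Q))
  set R := r ^ c with hRdef
  have hcR : c < R := Nat.lt_pow_self hr.one_lt
  have hQw : Q ≡ w [MOD P] := Int.natCast_modEq_iff.1 (by push_cast [hPdef, hQdef]; simpa using hb)
  have hRv : R ≡ v [MOD P] := Int.natCast_modEq_iff.1 (by push_cast [hPdef, hRdef]; simpa using hc)
  have hRt : R ≡ t [MOD Q] := Int.natCast_modEq_iff.1 (by push_cast [hQdef, hRdef]; simpa using hc')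
  have hPpos : 0 < P := by omega
  have hPP : 2 < s * P * P := by nlinarith [Nat.mul_pos hs0 hPpos]
  have hPQ5 : P * Q > 0 := Nat.mul_pos hPpos (by omega)
  refine ⟨b, c, by omega, by omega, fun n hn => ?_⟩
  have hfe : 4 * 1 ≤ p ^ e * f := Nat.mul_le_mul hpe4 hf1
  have hfge : p ^ e * f ≤ p ^ e * g := Nat.mul_le_mul_left _ hfg
  refine mem_coeffSet_inclExclPoly (v := v) (s := s) hP2 hs0 (by omega) (by omega) (by omega)
    (hcB.trans_lt hcR) ((cop hp hq hpq).pow _ _) ((cop hq hr hqr).pow _ _) ((cop hr hp hrp).pow _ _)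
    ?_ ?_ ?_ ?_ ?_
  · refine (hQw.add_right v).trans ?_
    rw [add_comm, hvw]
    simp [Nat.ModEq]
  · rw [mul_comm]
    exact (hQw.mul_right v).trans hvw1
  · refine (hRv.mul hQw).trans ?_
    rw [mul_comm]; exact hvw1
  · have h1 := (hRt.mul_right (s * P))
    rw [← mul_assoc] at h1
    refine h1.trans ?_
    have : t * (s * P) = P * s * t := by ring
    rw [this, Nat.ModEq, ht, Nat.mod_eq_of_lt (by omega)]
  · rw [← hf] at hn
    rw [hvdef]
    push_cast at hn ⊢
    linarith

theorem theorem2 (p q r : ℕ) (hp : p.Prime) (hq : q.Prime) (hr : r.Prime)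
    (hpq : p ≠ q) (hqr : q ≠ r) (hrp : r ≠ p) (ε : ℝ) (hε : 0 < ε) :
    ∃ a₀ : ℕ, ∀ a : ℕ, a₀ ≤ a → 2 < p ^ a ∧
      (∃ b c : ℕ, 2 < q ^ b ∧ 2 < r ^ c ∧
        {n : ℤ | |(n : ℝ)| ≤ (1 / 4 - ε) * (p : ℝ) ^ a} ⊆
          coeffSet (unitaryCyclotomic p a q b r c)) ∧
      (∃ b c : ℕ, 2 < q ^ b ∧ 2 < r ^ c ∧
        {n : ℤ | -1 ≤ n ∧ (n : ℝ) ≤ (1 / 2 - ε) * (p : ℝ) ^ a} ⊆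
          coeffSet (unitaryCyclotomic p a q b r c)) ∧
      (∃ b c : ℕ, 2 < q ^ b ∧ 2 < r ^ c ∧
        {n : ℤ | -1 ≤ -n ∧ ((-n : ℤ) : ℝ) ≤ (1 / 2 - ε) * (p : ℝ) ^ a} ⊆
          coeffSet (unitaryCyclotomic p a q b r c)) := by
  obtain ⟨k, hk⟩ := exists_pow_pow_coeffSet hp hq hr hpq hqr hrp
  -- Rounding `p ^ m / 2` down costs at most `p ^ e / 2`; together with the final `-1` this is below
  -- `ε * p ^ (e + m)` once `p ^ m > 2 / ε`.
  obtain ⟨N, hN⟩ := pow_unbounded_of_one_lt (2 / ε) (by exact_mod_cast hp.one_lt : (1 : ℝ) < p)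
  refine ⟨2 * (k + N + 2), fun a ha => ?_⟩
  obtain ⟨e, m, rfl, hme, hem⟩ : ∃ e m : ℕ, a = e + m ∧ m ≤ e ∧ k + N + 2 ≤ m :=
    ⟨a - a / 2, a / 2, by omega, by omega, by omega⟩
  obtain ⟨b, c, hb, hc, h⟩ := hk e m (by omega) (by omega) (by omega) hme
  have hp2 := hp.two_le
  have hpe : 4 ≤ p ^ e := by
    calc 4 = 2 ^ 2 := rfl
      _ ≤ p ^ 2 := Nat.pow_le_pow_left hp2 2
      _ ≤ p ^ e := Nat.pow_le_pow_right hp.pos (by omega)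
  have hpm : 2 ≤ p ^ m := hp2.trans (Nat.le_self_pow (by omega) p)
  set L := p ^ e * (p ^ m / 2) with hL
  have hL4 : 4 ≤ L := by
    have : 4 * 1 ≤ p ^ e * (p ^ m / 2) := Nat.mul_le_mul hpe (by omega)
    omega
  have hbound : (1 / 2 - ε) * (p : ℝ) ^ (e + m) ≤ L - 1 := by
    have h1 : 2 / ε < (p : ℝ) ^ m := hN.trans_le
      (pow_le_pow_right₀ (by exact_mod_cast hp.one_lt.le) (by omega))
    rw [div_lt_iff₀ hε] at h1
    have h2 : p ^ m ≤ 2 * (p ^ m / 2) + 1 := by omega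
    have h2' : (p : ℝ) ^ m ≤ 2 * ((p ^ m / 2 : ℕ) : ℝ) + 1 := by exact_mod_cast h2
    have hpe' : (4 : ℝ) ≤ (p : ℝ) ^ e := by exact_mod_cast hpe
    have hLR : (L : ℝ) = (p : ℝ) ^ e * ((p ^ m / 2 : ℕ) : ℝ) := by rw [hL]; push_cast; rfl
    rw [hLR, pow_add]
    nlinarith [mul_le_mul_of_nonneg_left h2' (by linarith : (0 : ℝ) ≤ (p : ℝ) ^ e),
      mul_lt_mul_of_pos_left h1 (by linarith : (0 : ℝ) < (p : ℝ) ^ e)]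
  have hpos : (0 : ℝ) ≤ (p : ℝ) ^ (e + m) := by positivity
  refine ⟨?_, ⟨b, c, hb, hc, fun n hn => h n ?_⟩, ⟨b, c, hb, hc, fun n hn => h n ?_⟩,
    ⟨b, c, hb, hc, fun n hn => h n ?_⟩⟩
  · rw [pow_add]; nlinarith
  · have h1 : |(n : ℝ)| ≤ (L : ℝ) - 1 := by
      have : |(n : ℝ)| ≤ (1 / 4 - ε) * (p : ℝ) ^ (e + m) := hn
      linarith
    exact_mod_cast h1
  · have h1 : (n : ℝ) ≤ (L : ℝ) - 1 := hn.2.trans hbound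
    have h2 : n ≤ (L : ℤ) - 1 := by exact_mod_cast h1
    have h3 : -1 ≤ n := hn.1
    exact abs_le.2 ⟨by omega, h2⟩
  · have h1 : ((-n : ℤ) : ℝ) ≤ (L : ℝ) - 1 := hn.2.trans hbound
    have h2 : -n ≤ (L : ℤ) - 1 := by exact_mod_cast h1
    have h3 : -1 ≤ -n := hn.1
    exact abs_le.2 ⟨by omega, by omega⟩
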